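/- Let $X$ and $Y$ be Banach spaces over $\mathbb K=\mathbb R$ or $\mathbb C$, and let $L(X,Y)$ (resp. $K(X,Y)$) denote the bounded (resp. compact) linear operators from $X$ to $Y$; write $N(\cdot)$ and $R(\cdot)$ for null space and range. An operator $T\in L(X,Y)$ is *regular* if $T=TT'T$ for some $T'\in L(Y,X)$. For $S\in L(X,Y)$, $T\in L(Y,X)$, the pair $(S,T)$ is a *Fredholm pair* if the quotients $N(S)/(N(S)\cap R(T))$, $R(T)/(N(S)\cap R(T))$, $N(T)/(N(T)\cap R(S))$ and $R(S)/(N(T)\cap R(S))$ are all finite dimensional; it is a *regular Fredholm pair* if moreover $S$ and $T$ are regular. For bounded operators $V\colon X_1\to X_2$ and $U\colon X_2\to X_3$, $(U,V)$ is a *chain* if $UV=0$. A chain is *exact* if $R(V)=N(U)$, and *invertible* if there are bounded linear operators $U_1\colon X_3\to X_2$ and $V_1\colon X_2\to X_1$ with $U_1U+VV_1=I_{X_2}$. For a Banach space $Z$ put $C(Z,X)=L(Z,X)/K(Z,X)$, and similarly for the other spaces. An operator $S\in L(X,Y)$ induces, for each $Z$, the operators $$\tilde L_S\colon C(Z,X)\to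 C(Z,Y),\ [V]\mapsto[SV],\qquad \tilde R_S\colon C(Y,Z)\to C(X,Z),\ [W]\mapsto[WS],$$ and $T\in L(Y,X)$ induces $\tilde L_T\colon C(Z,Y)\to C(Z,X)$ and $\tilde R_T\colon C(X,Z)\to C(Y,Z)$ in the same way. **Theorem.** Let $S\in L(X,Y)$ and $T\in L(Y,X)$ be such that $R(ST)$ and $R(TS)$ are finite dimensional. Then the following are equivalent: 1. $(S,T)$ is a regular Fredholm pair; 2. $S$ and $T$ are regular, and for every Banach space $Z$ both $(\tilde L_S,\tilde L_T)$ and $(\tilde L_T,\tilde L_S)$ are invertible chains; 3. $S$ and $T$ are regular, $(\tilde L_S,\tilde L_T)$ is an invertible chain for $Z=X$, and $(\tilde L_T,\tilde L_S)$ is an invertible chain for $Z=Y$; 4. $S$ and $T$ are regular, $(\tilde L_S,\tilde L_T)$ is an exact chain for $Z=X$, and $(\tilde L_T,\tilde L_S)$ is an exact chain for $Z=Y$. Likewise, the following are equivalent: 1. $(S,T)$ is a regular Fredholm pair; 2. $S$ and $T$ are regular, and for every Banach space $Z$ both $(\tilde R_S,\tilde R_T)$ and $(\tilde R_T,\tilde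 R_S)$ are invertible chains; 3. $S$ and $T$ are regular, $(\tilde R_S,\tilde R_T)$ is an invertible chain for $Z=Y$, and $(\tilde R_T,\tilde R_S)$ is an invertible chain for $Z=X$; 4. $S$ and $T$ are regular, $(\tilde R_S,\tilde R_T)$ is an exact chain for $Z=Y$, and $(\tilde R_T,\tilde R_S)$ is an exact chain for $Z=X$. -/

import Mathlib

universe u

namespace FredholmPairs

section Pairs

variable {𝕜 : Type*} [RCLike 𝕜]
  {X : Type*} [NormedAddCommGroup X] [NormedSpace 𝕜 X]
  {Y : Type*} [NormedAddCommGroup Y] [NormedSpace 𝕜 Y]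

/-- `(S, T)` is a Fredholm pair: the four quotients `N(S)/(N(S) ∩ R(T))`, `R(T)/(N(S) ∩ R(T))`,
`N(T)/(N(T) ∩ R(S))`, `R(S)/(N(T) ∩ R(S))` are finite dimensional. -/
structure IsFredholmPair (S : X →L[𝕜] Y) (T : Y →L[𝕜] X) : Prop where
  finite_a : FiniteDimensional 𝕜 (S.ker ⧸ (S.ker ⊓ T.range).submoduleOf S.ker)
  finite_b : FiniteDimensional 𝕜 (T.range ⧸ (S.ker ⊓ T.range).submoduleOf T.range)
  finite_c : FiniteDimensional 𝕜 (T.ker ⧸ (T.ker ⊓ S.range).submoduleOf T.ker)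
  finite_d : FiniteDimensional 𝕜 (S.range ⧸ (T.ker ⊓ S.range).submoduleOf S.range)

/-- `T` is regular (relatively Fredholm): it has a bounded generalized inverse. -/
def IsRegularOperator (T : X →L[𝕜] Y) : Prop :=
  ∃ T' : Y →L[𝕜] X, T = T ∘L T' ∘L T

/-- A regular Fredholm pair is a Fredholm pair of regular operators. -/
structure IsRegularFredholmPair (S : X →L[𝕜] Y) (T : Y →L[𝕜] X) : Prop where
  isFredholmPair : IsFredholmPair S T
  regular_left : IsRegularOperator S
  regular_right : IsRegularOperator T

end Pairs

section Chains

variable {𝕜 : Type*} [RCLike 𝕜]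
  {X₁ : Type*} [AddCommGroup X₁] [TopologicalSpace X₁] [IsTopologicalAddGroup X₁] [Module 𝕜 X₁]
  {X₂ : Type*} [AddCommGroup X₂] [TopologicalSpace X₂] [IsTopologicalAddGroup X₂] [Module 𝕜 X₂]
  {X₃ : Type*} [AddCommGroup X₃] [TopologicalSpace X₃] [IsTopologicalAddGroup X₃] [Module 𝕜 X₃]

/-- `(U, V)` is a chain `X₁ → X₂ → X₃`: `U V = 0`. -/
def IsChainPair (U : X₂ →L[𝕜] X₃) (V : X₁ →L[𝕜] X₂) : Prop :=
  U ∘L V = 0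

/-- A chain `(U, V)` is exact if `R(V) = N(U)`. -/
def IsExactChain (U : X₂ →L[𝕜] X₃) (V : X₁ →L[𝕜] X₂) : Prop :=
  IsChainPair U V ∧ V.range = U.ker

/-- A chain `(U, V)` is invertible if `U₁ U + V V₁ = I` on `X₂` for some continuous linear
`U₁ : X₃ → X₂` and `V₁ : X₂ → X₁`. -/
def IsInvertibleChain (U : X₂ →L[𝕜] X₃) (V : X₁ →L[𝕜] X₂) : Prop :=
  IsChainPair U V ∧ ∃ (U₁ : X₃ →L[𝕜] X₂) (V₁ : X₂ →L[𝕜] X₁),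
    U₁ ∘L U + V ∘L V₁ = ContinuousLinearMap.id 𝕜 X₂

end Chains

section Calkin

variable {𝕜 : Type*} [RCLike 𝕜]
  {X : Type*} [NormedAddCommGroup X] [NormedSpace 𝕜 X]
  {Y : Type*} [NormedAddCommGroup Y] [NormedSpace 𝕜 Y]

/-- `C(X, Y) = L(X, Y) / K(X, Y)`, with the quotient of the operator norm topology. -/
abbrev CalkinSpace (𝕜 : Type*) [RCLike 𝕜]
    (X : Type*) [NormedAddCommGroup X] [NormedSpace 𝕜 X]
    (Y : Type*) [NormedAddCommGroup Y] [NormedSpace 𝕜 Y] : Type _ :=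
  (X →L[𝕜] Y) ⧸ compactOperator (RingHom.id 𝕜) X Y

/-- The operator `C(Z, X) → C(Z, Y)`, `[V] ↦ [S V]`. -/
noncomputable def leftMul (Z : Type*) [NormedAddCommGroup Z] [NormedSpace 𝕜 Z] (S : X →L[𝕜] Y) :
    CalkinSpace 𝕜 Z X →L[𝕜] CalkinSpace 𝕜 Z Y :=
  (compactOperator (RingHom.id 𝕜) Z X).liftQL
    ((compactOperator (RingHom.id 𝕜) Z Y).mkQL ∘L ContinuousLinearMap.compL 𝕜 Z X Y S)
    (fun _ hV => (Submodule.Quotient.mk_eq_zero _).mpr (IsCompactOperator.clm_comp hV S))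

/-- The operator `C(Y, Z) → C(X, Z)`, `[W] ↦ [W S]`. -/
noncomputable def rightMul (Z : Type*) [NormedAddCommGroup Z] [NormedSpace 𝕜 Z] (S : X →L[𝕜] Y) :
    CalkinSpace 𝕜 Y Z →L[𝕜] CalkinSpace 𝕜 X Z :=
  (compactOperator (RingHom.id 𝕜) Y Z).liftQL
    ((compactOperator (RingHom.id 𝕜) X Z).mkQL ∘L (ContinuousLinearMap.compL 𝕜 X Y Z).flip S)
    (fun _ hW => (Submodule.Quotient.mk_eq_zero _).mpr (IsCompactOperator.comp_clm hW S))

theorem leftMul_mk (Z : Type*) [NormedAddCommGroup Z] [NormedSpace 𝕜 Z] (S : X →L[𝕜] Y)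
    (V : Z →L[𝕜] X) :
    leftMul Z S (Submodule.Quotient.mk V) = Submodule.Quotient.mk (S ∘L V) := rfl

theorem rightMul_mk (Z : Type*) [NormedAddCommGroup Z] [NormedSpace 𝕜 Z] (S : X →L[𝕜] Y)
    (W : Y →L[𝕜] Z) :
    rightMul Z S (Submodule.Quotient.mk W) = Submodule.Quotient.mk (W ∘L S) := rfl

end Calkin

end FredholmPairs

/-! Choose generalized inverses `S'`, `T'`. Then `P = I - S'S` projects onto `N(S)` and `Q = I -
TT'` projects along `R(T)`, so `N(S)/(N(S) ∩ R(T))` is isomorphic to `R(QP)`; swapping `S` and `T`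
gives the same on `Y`. The other two quotients embed in `R(ST)` and `R(TS)`. So the pair is Fredholm
iff the two products of projections have finite rank. As `ST` and `TS` have finite rank, these
products are idempotent modulo finite rank, and by Riesz they have finite rank as soon as they are
compact (`isFredholmPair_iff_isCompactOperator`).

Compactness is what the Calkin quotients detect. The identity `S'S + TT'P = I - QP` yields an
invertible chain for every `Z`. Conversely, exactness applied to the class of a single projection
makes the product compact. -/

namespace FredholmPairs

section Algebra

variable {𝕜 : Type*} [Field 𝕜] {E F : Type*} [AddCommGroup E] [Module 𝕜 E]
  [AddCommGroup F] [Module 𝕜 F]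

/-- If `q` is the kernel of `f` restricted to `p`, then `p ⧸ q` is finite dimensional exactly when
the image of `p` under `f` is. -/
theorem finiteDimensional_quotient_iff_map (f : E →ₗ[𝕜] F) {p q : Submodule 𝕜 E}
    (h : ∀ x ∈ p, x ∈ q ↔ f x = 0) :
    FiniteDimensional 𝕜 (p ⧸ q.submoduleOf p) ↔ FiniteDimensional 𝕜 (p.map f) := by
  have hq : q.submoduleOf p = (f.domRestrict p).ker := by
    ext x
    exact h x x.2
  have hr : (f.domRestrict p).range = p.map f := f.range_domRestrict p
  rw [hq, ← hr]
  exact Module.Finite.equiv_iff (f.domRestrict p).quotKerEquivRange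

end Algebra

section Normed

variable {𝕜 : Type*} [RCLike 𝕜]
  {X : Type*} [NormedAddCommGroup X] [NormedSpace 𝕜 X]
  {Y : Type*} [NormedAddCommGroup Y] [NormedSpace 𝕜 Y]

theorem isCompactOperator_congr {f g : X → Y} (hf : IsCompactOperator f) (h : ∀ x, g x = f x) :
    IsCompactOperator g :=
  (funext h : g = f) ▸ hf

theorem isCompactOperator_of_finiteDimensional_range (F : X →L[𝕜] Y)
    (hF : FiniteDimensional 𝕜 F.range) : IsCompactOperator F := by
  have : LocallyCompactSpace F.range := .of_finiteDimensional_of_complete 𝕜 F.range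
  have hc : IsCompactOperator (F.range.subtypeL : F.range →L[𝕜] Y) :=
    isCompactOperator_of_locallyCompactSpace_rng (F.range.subtypeL : F.range →L[𝕜] Y)
  exact hc.comp_clm (F.codRestrict F.range fun x => ⟨x, rfl⟩)

/-- Riesz: the fixed space of a compact operator is finite dimensional. -/
theorem finiteDimensional_ker_sub_id {F : X →L[𝕜] X} (hF : IsCompactOperator F) :
    FiniteDimensional 𝕜 (F - ContinuousLinearMap.id 𝕜 X).ker := by
  set N := (F - ContinuousLinearMap.id 𝕜 X).ker
  have hfix : ∀ x ∈ N, F x = x := fun x hx => sub_eq_zero.mp hx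
  have hinv : ∀ x ∈ N, F.toLinearMap x ∈ N := fun x hx => by
    rw [ContinuousLinearMap.coe_coe, hfix x hx]
    exact hx
  have hclosed : IsClosed (N : Set X) := (F - ContinuousLinearMap.id 𝕜 X).isClosed_ker
  have hc := IsCompactOperator.restrict (f := F.toLinearMap) hF hinv hclosed
  refine .of_isCompactOperator_id (𝕜 := 𝕜) ?_
  exact isCompactOperator_congr hc fun x => Subtype.ext (hfix x x.2).symm

/-- A compact operator that is idempotent up to finite rank has finite rank. -/
theorem finiteDimensional_range_of_isCompactOperator {F : X →L[𝕜] X} (hF : IsCompactOperator F)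
    (h : FiniteDimensional 𝕜 (F ∘L F - F).range) : FiniteDimensional 𝕜 F.range := by
  have hker := finiteDimensional_ker_sub_id hF
  -- `F - I` maps `R(F)` onto `R(F² - F)`, and its kernel is finite dimensional.
  refine Module.Finite.iff_fg.mpr (Submodule.fg_of_fg_map_of_fg_inf_ker
    (F - ContinuousLinearMap.id 𝕜 X).toLinearMap ?_ ?_)
  · rw [← LinearMap.range_comp]
    exact Module.Finite.iff_fg.mp h
  · exact Module.Finite.iff_fg.mp (Submodule.finiteDimensional_of_le inf_le_right)

/-- `I - S' S` projects onto `ker S` and `I - T T'` projects along `range T`; since `S T` has finite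
rank, their product has finite rank as soon as it is compact. -/
theorem finiteDimensional_range_comp_of_isCompactOperator
    {S : X →L[𝕜] Y} {S' : Y →L[𝕜] X} {T : Y →L[𝕜] X} {T' : X →L[𝕜] Y}
    (hS : S = S ∘L S' ∘L S) (hT : T = T ∘L T' ∘L T)
    (hST : FiniteDimensional 𝕜 (S ∘L T).range)
    (hc : IsCompactOperator
      ((.id 𝕜 X - T ∘L T') ∘L (.id 𝕜 X - S' ∘L S) : X →L[𝕜] X)) :
    FiniteDimensional 𝕜 ((.id 𝕜 X - T ∘L T') ∘L (.id 𝕜 X - S' ∘L S) : X →L[𝕜] X).range := by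
  refine finiteDimensional_range_of_isCompactOperator hc ?_
  have hS' : ∀ x, S (S' (S x)) = S x := fun x => (DFunLike.congr_fun hS x).symm
  have hT' : ∀ y, T (T' (T y)) = T y := fun y => (DFunLike.congr_fun hT y).symm
  refine Submodule.finiteDimensional_of_le
    (S₂ := (S ∘L T).range.map ((.id 𝕜 X - T ∘L T') ∘L S' : Y →L[𝕜] X).toLinearMap) ?_
  rintro _ ⟨x, rfl⟩
  -- With `P = I - S'S` and `Q = I - TT'`, `QPQP - QP = -QP(TT')P = QS'(ST)T'P`, because `QT = 0`.
  refine ⟨S (T (T' (x - S' (S x)))), ⟨T' (x - S' (S x)), rfl⟩, ?_⟩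
  simp only [ContinuousLinearMap.coe_coe, ContinuousLinearMap.comp_apply,
    sub_apply, ContinuousLinearMap.id_apply, map_sub, hS', hT']
  abel

/-- `I - TT'` has kernel `R(T)`, and it maps `N(S) = R(I - S'S)` onto the range of the product. -/
theorem finiteDimensional_quotient_ker_iff
    {S : X →L[𝕜] Y} {S' : Y →L[𝕜] X} {T : Y →L[𝕜] X} {T' : X →L[𝕜] Y}
    (hS : S = S ∘L S' ∘L S) (hT : T = T ∘L T' ∘L T) :
    FiniteDimensional 𝕜 (S.ker ⧸ (S.ker ⊓ T.range).submoduleOf S.ker) ↔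
      FiniteDimensional 𝕜
        ((.id 𝕜 X - T ∘L T') ∘L (.id 𝕜 X - S' ∘L S) : X →L[𝕜] X).range := by
  have hker : S.ker = (.id 𝕜 X - S' ∘L S : X →L[𝕜] X).range := by
    ext x
    constructor
    · intro hx
      have hx : S x = 0 := hx
      exact ⟨x, by simp [hx]⟩
    · rintro ⟨z, rfl⟩
      have hz : S z = S (S' (S z)) := DFunLike.congr_fun hS z
      simp [← hz]
  rw [finiteDimensional_quotient_iff_map (.id 𝕜 X - T ∘L T' : X →L[𝕜] X).toLinearMap]
  · rw [hker, ← LinearMap.range_comp]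
    rfl
  · intro x hx
    constructor
    · rintro ⟨-, y, rfl⟩
      have hy : T y = T (T' (T y)) := DFunLike.congr_fun hT y
      simp [← hy]
    · intro h
      exact ⟨hx, T' x, (sub_eq_zero.mp h).symm⟩

/-- `S` induces an isomorphism from this quotient onto `R(ST)`; regularity plays no role. -/
theorem finiteDimensional_quotient_range (S : X →L[𝕜] Y) (T : Y →L[𝕜] X)
    (hST : FiniteDimensional 𝕜 (S ∘L T).range) :
    FiniteDimensional 𝕜 (T.range ⧸ (S.ker ⊓ T.range).submoduleOf T.range) := by
  have hq : ∀ x ∈ T.range, x ∈ S.ker ⊓ T.range ↔ S.toLinearMap x = 0 := fun x hx =>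
    ⟨fun h => h.1, fun h => ⟨h, hx⟩⟩
  rw [finiteDimensional_quotient_iff_map S.toLinearMap hq, ← LinearMap.range_comp]
  exact hST

/-- For regular operators with finite rank products, being a Fredholm pair amounts to compactness
of two products of complementary projections. -/
theorem isFredholmPair_iff_isCompactOperator
    {S : X →L[𝕜] Y} {S' : Y →L[𝕜] X} {T : Y →L[𝕜] X} {T' : X →L[𝕜] Y}
    (hS : S = S ∘L S' ∘L S) (hT : T = T ∘L T' ∘L T)
    (hST : FiniteDimensional 𝕜 (S ∘L T).range) (hTS : FiniteDimensional 𝕜 (T ∘L S).range) :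
    IsFredholmPair S T ↔
      IsCompactOperator ((.id 𝕜 X - T ∘L T') ∘L (.id 𝕜 X - S' ∘L S) : X →L[𝕜] X) ∧
      IsCompactOperator ((.id 𝕜 Y - S ∘L S') ∘L (.id 𝕜 Y - T' ∘L T) : Y →L[𝕜] Y) := by
  constructor
  · intro h
    exact ⟨isCompactOperator_of_finiteDimensional_range _
        ((finiteDimensional_quotient_ker_iff hS hT).mp h.finite_a),
      isCompactOperator_of_finiteDimensional_range _
        ((finiteDimensional_quotient_ker_iff hT hS).mp h.finite_c)⟩
  · rintro ⟨h₁, h₂⟩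
    exact {
      finite_a := (finiteDimensional_quotient_ker_iff hS hT).mpr
        (finiteDimensional_range_comp_of_isCompactOperator hS hT hST h₁)
      finite_b := finiteDimensional_quotient_range S T hST
      finite_c := (finiteDimensional_quotient_ker_iff hT hS).mpr
        (finiteDimensional_range_comp_of_isCompactOperator hT hS hTS h₂)
      finite_d := finiteDimensional_quotient_range T S hTS }

theorem calkin_mk_eq_iff {V W : X →L[𝕜] Y} :
    (Submodule.Quotient.mk V : CalkinSpace 𝕜 X Y) = Submodule.Quotient.mk W ↔
      IsCompactOperator (V - W) :=
  Submodule.Quotient.eq _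

theorem isChainPair_leftMul (Z : Type*) [NormedAddCommGroup Z] [NormedSpace 𝕜 Z]
    {S : X →L[𝕜] Y} {T : Y →L[𝕜] X} (hST : FiniteDimensional 𝕜 (S ∘L T).range) :
    IsChainPair (leftMul Z S) (leftMul Z T) := by
  ext v
  obtain ⟨V, rfl⟩ := Submodule.Quotient.mk_surjective _ v
  exact (Submodule.Quotient.mk_eq_zero _).mpr
    ((isCompactOperator_of_finiteDimensional_range _ hST).comp_clm V)

theorem isChainPair_rightMul (Z : Type*) [NormedAddCommGroup Z] [NormedSpace 𝕜 Z]
    {S : X →L[𝕜] Y} {T : Y →L[𝕜] X} (hTS : FiniteDimensional 𝕜 (T ∘L S).range) :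
    IsChainPair (rightMul Z S) (rightMul Z T) := by
  ext w
  obtain ⟨W, rfl⟩ := Submodule.Quotient.mk_surjective _ w
  exact (Submodule.Quotient.mk_eq_zero _).mpr
    ((isCompactOperator_of_finiteDimensional_range _ hTS).clm_comp W)

theorem isInvertibleChain_leftMul (Z : Type*) [NormedAddCommGroup Z] [NormedSpace 𝕜 Z]
    {S : X →L[𝕜] Y} {S' : Y →L[𝕜] X} {T : Y →L[𝕜] X} {T' : X →L[𝕜] Y}
    (hST : FiniteDimensional 𝕜 (S ∘L T).range)
    (hc : IsCompactOperator
      ((.id 𝕜 X - T ∘L T') ∘L (.id 𝕜 X - S' ∘L S) : X →L[𝕜] X)) :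
    IsInvertibleChain (leftMul Z S) (leftMul Z T) := by
  -- These witnesses come from `S'S + TT'(I - S'S) = I - (I - TT')(I - S'S)`, whose last term is
  -- compact.
  refine ⟨isChainPair_leftMul Z hST, leftMul Z S', leftMul Z (T' ∘L (.id 𝕜 X - S' ∘L S)), ?_⟩
  refine ContinuousLinearMap.ext fun v => ?_
  obtain ⟨V, rfl⟩ := Submodule.Quotient.mk_surjective _ v
  have hV : IsCompactOperator
      (S' ∘L S ∘L V + T ∘L (T' ∘L (.id 𝕜 X - S' ∘L S)) ∘L V - V : Z →L[𝕜] X) := by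
    refine isCompactOperator_congr (hc.comp_clm V).neg fun z => ?_
    simp
    abel
  rw [add_apply, ContinuousLinearMap.comp_apply,
    ContinuousLinearMap.comp_apply, ContinuousLinearMap.id_apply, leftMul_mk, leftMul_mk, leftMul_mk, leftMul_mk, ← Submodule.Quotient.mk_add,
    calkin_mk_eq_iff]
  exact hV

theorem isInvertibleChain_rightMul (Z : Type*) [NormedAddCommGroup Z] [NormedSpace 𝕜 Z]
    {S : X →L[𝕜] Y} {S' : Y →L[𝕜] X} {T : Y →L[𝕜] X} {T' : X →L[𝕜] Y}
    (hTS : FiniteDimensional 𝕜 (T ∘L S).range)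
    (hc : IsCompactOperator
      ((.id 𝕜 Y - S ∘L S') ∘L (.id 𝕜 Y - T' ∘L T) : Y →L[𝕜] Y)) :
    IsInvertibleChain (rightMul Z S) (rightMul Z T) := by
  -- Here the identity is `SS'(I - T'T) + T'T = I - (I - SS')(I - T'T)`.
  refine ⟨isChainPair_rightMul Z hTS, rightMul Z (S' ∘L (.id 𝕜 Y - T' ∘L T)), rightMul Z T', ?_⟩
  ext w
  obtain ⟨W, rfl⟩ := Submodule.Quotient.mk_surjective _ w
  rw [add_apply, ContinuousLinearMap.comp_apply,
    ContinuousLinearMap.comp_apply, ContinuousLinearMap.id_apply, rightMul_mk, rightMul_mk, rightMul_mk, rightMul_mk, ← Submodule.Quotient.mk_add,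
    calkin_mk_eq_iff]
  refine isCompactOperator_congr (hc.clm_comp W).neg fun z => ?_
  simp
  abel

/-- Since `S(I - S'S) = 0`, exactness gives `I - S'S = TV + K` with `K` compact; multiplying on the
left by `I - TT'` kills `TV`. -/
theorem isCompactOperator_of_isExactChain_leftMul
    {S : X →L[𝕜] Y} {S' : Y →L[𝕜] X} {T : Y →L[𝕜] X} {T' : X →L[𝕜] Y}
    (hS : S = S ∘L S' ∘L S) (hT : T = T ∘L T' ∘L T)
    (h : IsExactChain (leftMul X S) (leftMul X T)) :
    IsCompactOperator ((.id 𝕜 X - T ∘L T') ∘L (.id 𝕜 X - S' ∘L S) : X →L[𝕜] X) := by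
  have hmem : (Submodule.Quotient.mk (.id 𝕜 X - S' ∘L S) : CalkinSpace 𝕜 X X) ∈
      (leftMul X S).ker := by
    have h0 : S ∘L (.id 𝕜 X - S' ∘L S) = 0 := by
      rw [ContinuousLinearMap.comp_sub, ← hS, ContinuousLinearMap.comp_id, sub_self]
    exact congrArg Submodule.Quotient.mk h0
  rw [← h.2] at hmem
  obtain ⟨v, hv⟩ := hmem
  obtain ⟨V, rfl⟩ := Submodule.Quotient.mk_surjective _ v
  have hK : IsCompactOperator (T ∘L V - (.id 𝕜 X - S' ∘L S) : X →L[𝕜] X) := calkin_mk_eq_iff.mp hv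
  refine isCompactOperator_congr (hK.clm_comp (.id 𝕜 X - T ∘L T' : X →L[𝕜] X)).neg fun x => ?_
  have hT' : T (V x) = T (T' (T (V x))) := DFunLike.congr_fun hT (V x)
  simp [← hT']
  abel

/-- Since `(I - SS')S = 0`, exactness gives `I - SS' = WT + K` with `K` compact; multiplying on the
right by `I - T'T` kills `WT`. -/
theorem isCompactOperator_of_isExactChain_rightMul
    {S : X →L[𝕜] Y} {S' : Y →L[𝕜] X} {T : Y →L[𝕜] X} {T' : X →L[𝕜] Y}
    (hS : S = S ∘L S' ∘L S) (hT : T = T ∘L T' ∘L T)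
    (h : IsExactChain (rightMul Y S) (rightMul Y T)) :
    IsCompactOperator ((.id 𝕜 Y - S ∘L S') ∘L (.id 𝕜 Y - T' ∘L T) : Y →L[𝕜] Y) := by
  have hmem : (Submodule.Quotient.mk (.id 𝕜 Y - S ∘L S') : CalkinSpace 𝕜 Y Y) ∈
      (rightMul Y S).ker := by
    have h0 : (.id 𝕜 Y - S ∘L S') ∘L S = 0 := by
      rw [ContinuousLinearMap.sub_comp, ContinuousLinearMap.comp_assoc, ← hS,
        ContinuousLinearMap.id_comp, sub_self]
    exact congrArg Submodule.Quotient.mk h0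
  rw [← h.2] at hmem
  obtain ⟨w, hw⟩ := hmem
  obtain ⟨W, rfl⟩ := Submodule.Quotient.mk_surjective _ w
  have hK : IsCompactOperator (W ∘L T - (.id 𝕜 Y - S ∘L S') : Y →L[𝕜] Y) := calkin_mk_eq_iff.mp hw
  refine isCompactOperator_congr (hK.comp_clm (.id 𝕜 Y - T' ∘L T : Y →L[𝕜] Y)).neg fun y => ?_
  have hT' : T y = T (T' (T y)) := DFunLike.congr_fun hT y
  simp [← hT']
  abel

end Normed

theorem IsInvertibleChain.isExactChain {𝕜 : Type*} [RCLike 𝕜]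
    {X₁ : Type*} [AddCommGroup X₁] [TopologicalSpace X₁] [IsTopologicalAddGroup X₁] [Module 𝕜 X₁]
    {X₂ : Type*} [AddCommGroup X₂] [TopologicalSpace X₂] [IsTopologicalAddGroup X₂] [Module 𝕜 X₂]
    {X₃ : Type*} [AddCommGroup X₃] [TopologicalSpace X₃] [IsTopologicalAddGroup X₃] [Module 𝕜 X₃]
    {U : X₂ →L[𝕜] X₃} {V : X₁ →L[𝕜] X₂} (h : IsInvertibleChain U V) : IsExactChain U V := by
  obtain ⟨hUV, U₁, V₁, hid⟩ := h
  refine ⟨hUV, le_antisymm ?_ fun x hx => ⟨V₁ x, ?_⟩⟩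
  · rintro _ ⟨x, rfl⟩
    exact DFunLike.congr_fun hUV x
  · have hx : U x = 0 := hx
    have := DFunLike.congr_fun hid x
    simpa [hx] using this

end FredholmPairs

theorem theorem5p4 {𝕜 : Type*} [RCLike 𝕜]
    {X Y : Type u} [NormedAddCommGroup X] [NormedSpace 𝕜 X] [CompleteSpace X]
    [NormedAddCommGroup Y] [NormedSpace 𝕜 Y] [CompleteSpace Y]
    (S : X →L[𝕜] Y) (T : Y →L[𝕜] X)
    (hST : FiniteDimensional 𝕜 (S ∘L T).range) (hTS : FiniteDimensional 𝕜 (T ∘L S).range) :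
    List.TFAE [
      FredholmPairs.IsRegularFredholmPair S T,
      FredholmPairs.IsRegularOperator S ∧ FredholmPairs.IsRegularOperator T ∧
        ∀ (Z : Type u) [NormedAddCommGroup Z] [NormedSpace 𝕜 Z] [CompleteSpace Z],
          FredholmPairs.IsInvertibleChain
            (FredholmPairs.leftMul Z S) (FredholmPairs.leftMul Z T) ∧
          FredholmPairs.IsInvertibleChain
            (FredholmPairs.leftMul Z T) (FredholmPairs.leftMul Z S),
      FredholmPairs.IsRegularOperator S ∧ FredholmPairs.IsRegularOperator T ∧
        FredholmPairs.IsInvertibleChain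
          (FredholmPairs.leftMul X S) (FredholmPairs.leftMul X T) ∧
        FredholmPairs.IsInvertibleChain
          (FredholmPairs.leftMul Y T) (FredholmPairs.leftMul Y S),
      FredholmPairs.IsRegularOperator S ∧ FredholmPairs.IsRegularOperator T ∧
        FredholmPairs.IsExactChain
          (FredholmPairs.leftMul X S) (FredholmPairs.leftMul X T) ∧
        FredholmPairs.IsExactChain
          (FredholmPairs.leftMul Y T) (FredholmPairs.leftMul Y S)] ∧
    List.TFAE [
      FredholmPairs.IsRegularFredholmPair S T,
      FredholmPairs.IsRegularOperator S ∧ FredholmPairs.IsRegularOperator T ∧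
        ∀ (Z : Type u) [NormedAddCommGroup Z] [NormedSpace 𝕜 Z] [CompleteSpace Z],
          FredholmPairs.IsInvertibleChain
            (FredholmPairs.rightMul Z S) (FredholmPairs.rightMul Z T) ∧
          FredholmPairs.IsInvertibleChain
            (FredholmPairs.rightMul Z T) (FredholmPairs.rightMul Z S),
      FredholmPairs.IsRegularOperator S ∧ FredholmPairs.IsRegularOperator T ∧
        FredholmPairs.IsInvertibleChain
          (FredholmPairs.rightMul Y S) (FredholmPairs.rightMul Y T) ∧
        FredholmPairs.IsInvertibleChain
          (FredholmPairs.rightMul X T) (FredholmPairs.rightMul X S),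
      FredholmPairs.IsRegularOperator S ∧ FredholmPairs.IsRegularOperator T ∧
        FredholmPairs.IsExactChain
          (FredholmPairs.rightMul Y S) (FredholmPairs.rightMul Y T) ∧
        FredholmPairs.IsExactChain
          (FredholmPairs.rightMul X T) (FredholmPairs.rightMul X S)] := by
  refine ⟨?_, ?_⟩
  · tfae_have 1 → 2 := by
      rintro ⟨h, ⟨S', hS⟩, ⟨T', hT⟩⟩
      obtain ⟨h₁, h₂⟩ :=
        (FredholmPairs.isFredholmPair_iff_isCompactOperator hS hT hST hTS).mp h
      exact ⟨⟨S', hS⟩, ⟨T', hT⟩, fun Z _ _ _ =>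
        ⟨FredholmPairs.isInvertibleChain_leftMul Z hST h₁,
          FredholmPairs.isInvertibleChain_leftMul Z hTS h₂⟩⟩
    tfae_have 2 → 3 := fun ⟨hS, hT, h⟩ => ⟨hS, hT, (h X).1, (h Y).2⟩
    tfae_have 3 → 4 := fun ⟨hS, hT, h₁, h₂⟩ => ⟨hS, hT, h₁.isExactChain, h₂.isExactChain⟩
    tfae_have 4 → 1 := by
      rintro ⟨⟨S', hS⟩, ⟨T', hT⟩, h₁, h₂⟩
      exact ⟨(FredholmPairs.isFredholmPair_iff_isCompactOperator hS hT hST hTS).mpr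
        ⟨FredholmPairs.isCompactOperator_of_isExactChain_leftMul hS hT h₁,
          FredholmPairs.isCompactOperator_of_isExactChain_leftMul hT hS h₂⟩, ⟨S', hS⟩, ⟨T', hT⟩⟩
    tfae_finish
  · tfae_have 1 → 2 := by
      rintro ⟨h, ⟨S', hS⟩, ⟨T', hT⟩⟩
      obtain ⟨h₁, h₂⟩ :=
        (FredholmPairs.isFredholmPair_iff_isCompactOperator hS hT hST hTS).mp h
      -- Right multiplication reverses composition, so the roles of the two products, and of `ST`
      -- and `TS`, are exchanged.
      exact ⟨⟨S', hS⟩, ⟨T', hT⟩, fun Z _ _ _ =>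
        ⟨FredholmPairs.isInvertibleChain_rightMul Z hTS h₂,
          FredholmPairs.isInvertibleChain_rightMul Z hST h₁⟩⟩
    tfae_have 2 → 3 := fun ⟨hS, hT, h⟩ => ⟨hS, hT, (h Y).1, (h X).2⟩
    tfae_have 3 → 4 := fun ⟨hS, hT, h₁, h₂⟩ => ⟨hS, hT, h₁.isExactChain, h₂.isExactChain⟩
    tfae_have 4 → 1 := by
      rintro ⟨⟨S', hS⟩, ⟨T', hT⟩, h₁, h₂⟩
      exact ⟨(FredholmPairs.isFredholmPair_iff_isCompactOperator hS hT hST hTS).mpr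
        ⟨FredholmPairs.isCompactOperator_of_isExactChain_rightMul hT hS h₂,
          FredholmPairs.isCompactOperator_of_isExactChain_rightMul hS hT h₁⟩, ⟨S', hS⟩, ⟨T', hT⟩⟩
    tfae_finish
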